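/- Let $k\ge 2$ and $d\ge 1$ be integers with $k\le d+1$, let $\mathbb S^{d-1}$ be the unit sphere of $\mathbb R^d$, and let $\sigma$ be its uniform probability measure. Let $l\ge 0$ be an integer, with $l\le 1$ if $k=d+1$. For $n\ge2$ let $P^n_l$ be the Gegenbauer polynomial of degree $l$, i.e. the polynomials $P^n_0,P^n_1,\dots$ (with $\deg P^n_l=l$) are orthogonal on $[-1,1]$ for the weight $(1-t^2)^{(n-3)/2}$ and $P_l^n(1)=1$; put $P^1_0=1$, $P^1_1(t)=t$. For $x_1,\dots,x_k\in\mathbb S^{d-1}$ let $W$ be the Gram matrix of $x_3,\dots,x_k$ (with $\det W=1$ if $k=2$), let $y_1,y_2$ be the orthogonal projections of $x_1,x_2$ onto $\operatorname{span}\{x_3,\dots,x_k\}^\perp$, and set $$Q^d_{k,l}(x_1,\dots,x_k)=\det(W)^l\,\|y_1\|^l\,\|y_2\|^l\,P_l^{d-k+2}\!\left(\left\langle \tfrac{y_1}{\|y_1\|},\tfrac{y_2}{\|y_2\|}\right\rangle\right),$$ with the convention that, where $x_3,\dots,x_k$ are linearly dependent or $y_1=0$ or $y_2=0$, the value is $0$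 if $l\ge1$ and $1$ if $l=0$. Let $G:(\mathbb S^{d-1})^{k-1}\to\mathbb R$ be continuous and such that $G(\eta_1,\dots,\eta_{k-1})$ depends only on the inner products $\langle\eta_i,\eta_j\rangle$, $1\le i<j\le k-1$. Then the kernel $$T(x_1,\dots,x_k)=G(x_1,x_3,\dots,x_k)\,G(x_2,x_3,\dots,x_k)\,Q^d_{k,l}(x_1,\dots,x_k)$$ is invariant under the simultaneous action of the orthogonal group on its $k$ arguments, and it is $k$-positive definite, that is: $T$ is continuous, symmetric in its first two arguments, and for all $z_3,\dots,z_k\in\mathbb S^{d-1}$ and every finite signed Borel measure $\nu$ on $\mathbb S^{d-1}$, $$\int\!\!\int T(x,y,z_3,\dots,z_k)\,d\nu(x)\,d\nu(y)\ge 0 .$$ If moreover $l\ge1$, then, with $I_T(\mu)=\int\cdots\int T(x_1,\dots,x_k)\,d\mu(x_1)\cdots d\mu(x_k)$, $$\inf_{\mu} I_T(\mu)=I_T(\sigma)=0,$$ where $\mu$ runs over all Borel probability measures on $\mathbb S^{d-1}$. -/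

import Mathlib

open MeasureTheory

noncomputable section

namespace KPoint

/-! ### Gegenbauer polynomials -/

/-- The Gegenbauer polynomial `P_l^n` of degree `l` for the unit sphere of `ℝ^n`, normalized by
`P_l^n(1) = 1`, through its three-term recurrence `P_0 = 1`, `P_1 = t` and
`(l + n - 2) P_l = (2 l + n - 4) t P_{l-1} - (l - 1) P_{l-2}`.
For `n ≥ 2` the lemmas below show that it is the polynomial of degree `l` with value `1` at `1`,
orthogonal to the others for the weight `(1 - t^2)^((n-3)/2)` on `[-1, 1]`. For `n = 1` only
`P_0 = 1` and `P_1 = t` are meaningful. -/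
def gegenbauer (n : ℕ) : ℕ → Polynomial ℝ
  | 0 => 1
  | 1 => Polynomial.X
  | l + 2 => Polynomial.C ((l + n - 1 : ℝ)⁻¹) *
      (Polynomial.C (2 * l + n : ℝ) * Polynomial.X * gegenbauer n (l + 1)
        - Polynomial.C (l + 1 : ℝ) * gegenbauer n l)

theorem gegenbauer_rec (n : ℕ) (hn : 2 ≤ n) (l : ℕ) :
    Polynomial.C (l + n - 1 : ℝ) * gegenbauer n (l + 2) =
      Polynomial.C (2 * l + n : ℝ) * Polynomial.X * gegenbauer n (l + 1)
        - Polynomial.C (l + 1 : ℝ) * gegenbauer n l := by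
  have h : (l + n - 1 : ℝ) ≠ 0 := by
    have h1 : (2 : ℝ) ≤ n := by exact_mod_cast hn
    have h2 : (0 : ℝ) ≤ l := Nat.cast_nonneg l
    linarith
  rw [gegenbauer, ← mul_assoc, ← Polynomial.C_mul, mul_inv_cancel₀ h, Polynomial.C_1, one_mul]

theorem gegenbauer_eval_one (n : ℕ) (hn : 2 ≤ n) (l : ℕ) : (gegenbauer n l).eval 1 = 1 := by
  induction l using Nat.twoStepInduction with
  | zero => simp [gegenbauer]
  | one => simp [gegenbauer]
  | more l h0 h1 =>
    have h := congrArg (Polynomial.eval 1) (gegenbauer_rec n hn l)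
    simp only [Polynomial.eval_mul, Polynomial.eval_sub, Polynomial.eval_C, Polynomial.eval_X,
      h0, h1] at h
    have h1 : (2 : ℝ) ≤ n := by exact_mod_cast hn
    have h2 : (0 : ℝ) ≤ l := Nat.cast_nonneg l
    have h3 : (l + n - 1 : ℝ) ≠ 0 := by linarith
    apply mul_left_cancel₀ h3
    linarith

theorem gegenbauer_natDegree (n : ℕ) (hn : 2 ≤ n) (l : ℕ) : (gegenbauer n l).natDegree = l := by
  suffices h : (gegenbauer n l).natDegree ≤ l ∧ (gegenbauer n l).coeff l ≠ 0 from
    le_antisymm h.1 (Polynomial.le_natDegree_of_ne_zero h.2)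
  have hn' : (2 : ℝ) ≤ n := by exact_mod_cast hn
  induction l using Nat.twoStepInduction with
  | zero => simp [gegenbauer]
  | one => simp [gegenbauer]
  | more l h0 h1 =>
    have h2 : (0 : ℝ) ≤ l := Nat.cast_nonneg l
    have h3 : (l + n - 1 : ℝ) ≠ 0 := by linarith
    have h4 : (2 * l + n : ℝ) ≠ 0 := by linarith
    rw [gegenbauer]
    constructor
    · refine (Polynomial.natDegree_C_mul_le _ _).trans
        ((Polynomial.natDegree_sub_le _ _).trans (max_le ?_ ?_))
      · rw [mul_assoc]
        refine (Polynomial.natDegree_C_mul_le _ _).trans (Polynomial.natDegree_mul_le.trans ?_)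
        rw [Polynomial.natDegree_X]
        omega
      · exact (Polynomial.natDegree_C_mul_le _ _).trans (by omega)
    · have h5 : (gegenbauer n l).coeff (l + 2) = 0 :=
        Polynomial.coeff_eq_zero_of_natDegree_lt (by omega)
      rw [Polynomial.coeff_C_mul, Polynomial.coeff_sub, mul_assoc, Polynomial.coeff_C_mul,
        Polynomial.coeff_C_mul, Polynomial.coeff_X_mul, h5, mul_zero, sub_zero]
      exact mul_ne_zero (inv_ne_zero h3) (mul_ne_zero h4 h1.2)

/-- The two first-order relations between consecutive Gegenbauer polynomials. -/
theorem gegenbauer_derivative (n : ℕ) (hn : 2 ≤ n) (l : ℕ) :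
    (1 - Polynomial.X ^ 2) * Polynomial.derivative (gegenbauer n l) =
      Polynomial.C (l + n - 2 : ℝ) *
        (Polynomial.X * gegenbauer n l - gegenbauer n (l + 1)) ∧
    (1 - Polynomial.X ^ 2) * Polynomial.derivative (gegenbauer n (l + 1)) =
      Polynomial.C (l + 1 : ℝ) *
        (gegenbauer n l - Polynomial.X * gegenbauer n (l + 1)) := by
  induction l with
  | zero =>
    simp [gegenbauer]
    ring
  | succ l ih =>
    have hr := gegenbauer_rec n hn l
    have hd := congrArg Polynomial.derivative hr
    obtain ⟨hB, hA⟩ := ih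
    have h1 : (l + n - 1 : ℝ) ≠ 0 := by
      have h1 : (2 : ℝ) ≤ n := by exact_mod_cast hn
      have h2 : (0 : ℝ) ≤ l := Nat.cast_nonneg l
      linarith
    have hC : Polynomial.C (l + n - 1 : ℝ) ≠ 0 := Polynomial.C_ne_zero.2 h1
    simp only [Polynomial.derivative_mul, Polynomial.derivative_sub, Polynomial.derivative_C,
      Polynomial.derivative_X, zero_mul, zero_add, mul_one] at hd
    simp only [map_add, map_sub, map_mul, map_ofNat, map_natCast, map_one, Nat.cast_add,
      Nat.cast_one] at hr hd hA hB hC ⊢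
    constructor
    · linear_combination hA + hr
    · apply mul_left_cancel₀ hC
      linear_combination (1 - Polynomial.X ^ 2) * hd
        + (2 * (l : Polynomial ℝ) + n) * Polynomial.X * hA - (l + 1 : Polynomial ℝ) * hB
        + ((l : Polynomial ℝ) + 2) * Polynomial.X * hr

/-- The Gegenbauer differential equation. -/
theorem gegenbauer_ode (n : ℕ) (hn : 2 ≤ n) (l : ℕ) :
    (1 - Polynomial.X ^ 2) *
        Polynomial.derivative (Polynomial.derivative (gegenbauer n l)) =
      Polynomial.C (n - 1 : ℝ) * Polynomial.X * Polynomial.derivative (gegenbauer n l)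
        - Polynomial.C (l * (l + n - 2) : ℝ) * gegenbauer n l := by
  have hX : (1 - Polynomial.X ^ 2 : Polynomial ℝ) ≠ 0 := by
    intro h
    have := congrArg (Polynomial.eval 0) h
    simp at this
  obtain ⟨hB, hA⟩ := gegenbauer_derivative n hn l
  have hd := congrArg Polynomial.derivative hB
  apply mul_left_cancel₀ hX
  simp only [Polynomial.derivative_mul, Polynomial.derivative_sub, Polynomial.derivative_C,
    Polynomial.derivative_X, Polynomial.derivative_X_pow, Polynomial.derivative_one,
    zero_mul, zero_add, zero_sub, one_mul] at hd
  simp only [map_add, map_sub, map_mul, map_ofNat, map_natCast, map_one] at hd hA hB ⊢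
  norm_num at hd
  linear_combination (1 - Polynomial.X ^ 2) * hd - ((l : Polynomial ℝ) + n - 2) * hA
    + ((l : Polynomial ℝ) + 1) * Polynomial.X * hB

/-- The Gegenbauer polynomials are orthogonal for the weight `(1 - t^2)^((n-3)/2)`. -/
theorem gegenbauer_orthogonal (n : ℕ) (hn : 2 ≤ n) (i j : ℕ) (hij : i ≠ j) :
    ∫ t in (-1 : ℝ)..1, (gegenbauer n i).eval t * (gegenbauer n j).eval t *
      (1 - t ^ 2) ^ (((n : ℝ) - 3) / 2) = 0 := by
  have hn' : (2 : ℝ) ≤ n := by exact_mod_cast hn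
  set P := gegenbauer n i with hP
  set R := gegenbauer n j with hR
  set a : ℝ := ((n : ℝ) - 3) / 2 with ha
  set c : ℝ := (j * (j + n - 2) : ℝ) - i * (i + n - 2) with hc
  have hc0 : c ≠ 0 := by
    have h : c = ((j : ℝ) - i) * (j + i + n - 2) := by rw [hc]; ring
    have h1 : ((j : ℝ) - i) ≠ 0 := sub_ne_zero.2 (by exact_mod_cast hij.symm)
    have h2 : (1 : ℝ) ≤ (j : ℝ) + i := by
      have : 1 ≤ j + i := by omega
      exact_mod_cast this
    rw [h]
    exact mul_ne_zero h1 (by linarith)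
  set F : ℝ → ℝ := fun t => (1 - t ^ 2) ^ (a + 1) *
    (P.derivative.eval t * R.eval t - P.eval t * R.derivative.eval t) with hF
  have hFc : Continuous F := by
    refine Continuous.mul ?_ (by fun_prop)
    exact Continuous.rpow_const (by fun_prop) fun t => Or.inr (by rw [ha]; linarith)
  have hFd : ∀ t ∈ Set.Ioo (-1 : ℝ) 1,
      HasDerivAt F (c * (P.eval t * R.eval t * (1 - t ^ 2) ^ a)) t := by
    intro t ht
    have hpos : 0 < 1 - t ^ 2 := by nlinarith [ht.1, ht.2]
    have e1 := congrArg (Polynomial.eval t) (gegenbauer_ode n hn i)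
    have e2 := congrArg (Polynomial.eval t) (gegenbauer_ode n hn j)
    rw [← hP] at e1
    rw [← hR] at e2
    simp only [Polynomial.eval_mul, Polynomial.eval_sub, Polynomial.eval_pow,
      Polynomial.eval_C, Polynomial.eval_X, Polynomial.eval_one] at e1 e2
    have d0 : HasDerivAt (fun t : ℝ => 1 - t ^ 2) (-(2 * t)) t := by
      simpa using ((hasDerivAt_pow 2 t).const_sub 1)
    have d1 := d0.rpow_const (p := a + 1) (Or.inl hpos.ne')
    have d2 := ((P.derivative.hasDerivAt t).mul (R.hasDerivAt t)).sub
      ((P.hasDerivAt t).mul (R.derivative.hasDerivAt t))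
    refine (d1.mul d2).congr_deriv ?_
    have hpw : (1 - t ^ 2) ^ (a + 1) = (1 - t ^ 2) ^ a * (1 - t ^ 2) := Real.rpow_add_one hpos.ne' a
    have h2a : (n : ℝ) = 2 * a + 3 := by rw [ha]; ring
    simp only [Pi.mul_apply, Pi.sub_apply, add_sub_cancel_right, hpw, hc]
    rw [h2a] at e1 e2 ⊢
    linear_combination (1 - t ^ 2) ^ a * (R.eval t * e1 - P.eval t * e2)
  have hw : IntervalIntegrable (fun t : ℝ => (1 - t ^ 2) ^ a) volume (-1) 1 := by
    have h := Polynomial.Chebyshev.intervalIntegrable_sqrt_one_sub_sq_inv.continuousOn_mul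
      (g := fun t : ℝ => (1 - t ^ 2) ^ (a + 1 / 2))
      (Continuous.continuousOn (Continuous.rpow_const (by fun_prop)
        fun t => Or.inr (by rw [ha]; linarith)))
    refine h.congr_uIoo fun t ht => ?_
    rw [Set.uIoo_of_le (by norm_num)] at ht
    have hpos : 0 < 1 - t ^ 2 := by nlinarith [ht.1, ht.2]
    have : (1 - t ^ 2) ^ (a + 1 / 2) = (1 - t ^ 2) ^ a * √(1 - t ^ 2) := by
      rw [Real.rpow_add hpos, Real.sqrt_eq_rpow]
    simp only [this, Real.sqrt_inv]
    rw [mul_assoc, mul_inv_cancel₀ (Real.sqrt_pos.2 hpos).ne', mul_one]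
  have hint : IntervalIntegrable (fun t : ℝ => c * (P.eval t * R.eval t * (1 - t ^ 2) ^ a))
      volume (-1) 1 :=
    (hw.continuousOn_mul (g := fun t => P.eval t * R.eval t)
      (Continuous.continuousOn (by fun_prop))).const_mul c
  have hfin := intervalIntegral.integral_eq_sub_of_hasDerivAt_of_le (by norm_num)
    hFc.continuousOn hFd hint
  have hz : (0 : ℝ) ^ (a + 1) = 0 := Real.zero_rpow (by rw [ha]; linarith)
  rw [intervalIntegral.integral_const_mul] at hfin
  have hb : F 1 - F (-1) = 0 := by simp [hF, hz]
  rw [hb] at hfin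
  exact (mul_eq_zero.1 hfin).resolve_left hc0

/-! ### The sphere, its uniform measure, energies -/

/-- The unit sphere of `ℝ^d`. -/
abbrev Sph (d : ℕ) : Type := Metric.sphere (0 : EuclideanSpace ℝ (Fin d)) 1

/-- The uniform (normalized surface) measure on the sphere. -/
def sigma (d : ℕ) : Measure (Sph d) :=
  ((volume : Measure (EuclideanSpace ℝ (Fin d))).toSphere Set.univ)⁻¹ •
    (volume : Measure (EuclideanSpace ℝ (Fin d))).toSphere

/-- The uniform measure is a probability measure. -/
theorem isProbabilityMeasure_sigma (d : ℕ) (hd : 0 < d) : IsProbabilityMeasure (sigma d) := by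
  have : Nonempty (Fin d) := ⟨⟨0, hd⟩⟩
  refine ⟨?_⟩
  rw [sigma, Measure.smul_apply, smul_eq_mul]
  refine ENNReal.inv_mul_cancel ?_ (measure_ne_top _ _)
  rw [Ne, Measure.measure_univ_eq_zero]
  exact Measure.toSphere_ne_zero _

/-- The energy integral `∫ … ∫ K(x_1, …, x_k) dμ(x_1) … dμ(x_k)` of a kernel with `k` inputs. -/
def energy {d k : ℕ} (K : (Fin k → Sph d) → ℝ) (μ : Measure (Sph d)) : ℝ :=
  ∫ x, K x ∂(Measure.pi fun _ : Fin k => μ)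

/-- A two-input kernel is positive definite if it is symmetric and its energy
`∫ ∫ K(x, y) dν(x) dν(y)` is nonnegative for every finite signed Borel measure `ν`. -/
def IsPosDef {d : ℕ} (K : Sph d → Sph d → ℝ) : Prop :=
  (∀ x y, K x y = K y x) ∧
    ∀ ν : SignedMeasure (Sph d), 0 ≤ ∫ᵛ y, (∫ᵛ x, K x y ∂<•ν) ∂<•ν

/-- A kernel with `k = m + 2` inputs is `k`-positive definite if it is continuous, symmetric in
its first two inputs, and positive definite in these for all fixed values `z` of the others. -/
def IsKPosDef {d m : ℕ} (K : (Fin (m + 2) → Sph d) → ℝ) : Prop :=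
  Continuous K ∧
    (∀ x y : Sph d, ∀ z : Fin m → Sph d,
      K (Fin.cons x (Fin.cons y z)) = K (Fin.cons y (Fin.cons x z))) ∧
    ∀ z : Fin m → Sph d, IsPosDef fun x y => K (Fin.cons x (Fin.cons y z))

/-- The image of a point of the sphere under an orthogonal transformation. -/
def rotate {d : ℕ} (A : EuclideanSpace ℝ (Fin d) ≃ₗᵢ[ℝ] EuclideanSpace ℝ (Fin d)) (x : Sph d) :
    Sph d :=
  ⟨A x, by simp⟩

/-- Invariance of a kernel under the simultaneous action of the orthogonal group on its inputs. -/
def IsRotationInvariant {d k : ℕ} (K : (Fin k → Sph d) → ℝ) : Prop :=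
  ∀ (A : EuclideanSpace ℝ (Fin d) ≃ₗᵢ[ℝ] EuclideanSpace ℝ (Fin d)) (x : Fin k → Sph d),
    K (fun i => rotate A (x i)) = K x

/-- `G` depends only on the inner products `⟨η_i, η_j⟩`, `i < j`, of its inputs. -/
def DependsOnlyOnInner {d k : ℕ} (G : (Fin k → Sph d) → ℝ) : Prop :=
  ∀ η ξ : Fin k → Sph d,
    (∀ i j, i < j → inner ℝ (η i : EuclideanSpace ℝ (Fin d)) (η j) =
      inner ℝ (ξ i : EuclideanSpace ℝ (Fin d)) (ξ j)) → G η = G ξ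

/-! ### The kernels -/

/-- The last `k - 2` inputs `x_3, …, x_k` (where `k = m + 2`). -/
def tail {d m : ℕ} (x : Fin (m + 2) → Sph d) : Fin m → Sph d := fun i => x i.succ.succ

/-- The orthogonal projection of `v` onto the orthogonal complement of the span of the `z_i`. -/
def perp {d m : ℕ} (z : Fin m → Sph d) (v : Sph d) : EuclideanSpace ℝ (Fin d) :=
  ((Submodule.span ℝ (Set.range fun i => (z i : EuclideanSpace ℝ (Fin d))))ᗮ).starProjection v

/-- The kernel `Q_{k,l}^d`, for `k = m + 2 ≤ d + 1` (so that `d - k + 2 = d - m ≥ 1`):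
`det(W)^l ‖y_1‖^l ‖y_2‖^l P_l^{d-k+2}(⟨y_1/‖y_1‖, y_2/‖y_2‖⟩)`, with `W` the Gram matrix of
`x_3, …, x_k` and `y_h` the projection of `x_h` onto the orthogonal complement of their span.
For `l ≥ 1` the value is `0` where `x_3, …, x_k` are linearly dependent or `y_1 = 0` or `y_2 = 0`;
for `l = 0` the value is `1` everywhere. -/
def Q (d l : ℕ) {m : ℕ} (x : Fin (m + 2) → Sph d) : ℝ :=
  (Matrix.gram ℝ fun i => (tail x i : EuclideanSpace ℝ (Fin d))).det ^ l *
    ‖perp (tail x) (x 0)‖ ^ l * ‖perp (tail x) (x 1)‖ ^ l *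
    (gegenbauer (d - m) l).eval
      (inner ℝ (‖perp (tail x) (x 0)‖⁻¹ • perp (tail x) (x 0))
        (‖perp (tail x) (x 1)‖⁻¹ • perp (tail x) (x 1)))

/-- The kernel `T = G(x_1, x_3, …, x_k) G(x_2, x_3, …, x_k) Q_{k,l}^d(x_1, …, x_k)`. -/
def T (d l : ℕ) {m : ℕ} (G : (Fin (m + 1) → Sph d) → ℝ) (x : Fin (m + 2) → Sph d) : ℝ :=
  G (Fin.cons (x 0) (tail x)) * G (Fin.cons (x 1) (tail x)) * Q d l x

end KPoint

end

/-! Fix `z = (x_3, …, x_k)`. The heart of the matter is `exists_features`: `T(x, y, z)` is a finite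
sum `∑ F_i(x) F_i(y)` with continuous `F_i`, and every `F_i` has `σ`-mean zero when `l ≥ 1`. The
double integral of `T` against `ν` is then `∑ (∫ F_i dν)²`. This gives positive definiteness, and
after integrating over `z` last, it gives energies that are nonnegative for every `μ` and zero for
`σ`.

To find the `F_i` when the Gram determinant `D` of `z` is nonzero, let `a(x) ∈ ℝ^n`, `n = d - m`, be
the coordinates of the projection of `x` in an orthonormal frame of `span(z)ᗮ`. Then `Q` is `D^l`
times the homogenized Gegenbauer polynomial of `a(x)` and `a(y)`. By `exists_fischer_zonal` this is,
up to a positive factor, the Fischer product of the zonal harmonics with poles `a(x)` and `a(y)`.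
Expanding that product in monomials gives `F_α(x) = const · G(x, z) · coeff_α(zonal l (a x))`.

For the means, the averaged polynomial `∫ G(x, z) zonal l (a x) dσ(x)` is a harmonic form of degree
`l`. Invariance of `G(·, z)` and `σ` under the stabilizer of `z` makes it constant on spheres of
`ℝ^n`, and for `l ≥ 1` such a form vanishes (`eq_zero_of_radial`).

Continuity of `T`, including at degenerate configurations, comes from rewriting `Q` without
divisions (`Q_eq`, `detInner_eq`). -/

noncomputable section

namespace KPoint

/-! ### The Fischer form on polynomials -/

section Fischer

open MvPolynomial

variable {n : ℕ}

/-- The Fischer form: monomials are orthogonal and `X^α` has square norm `α!`. -/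
def fischer : MvPolynomial (Fin n) ℝ →ₗ[ℝ] MvPolynomial (Fin n) ℝ →ₗ[ℝ] ℝ :=
  (basisMonomials (Fin n) ℝ).constr ℝ fun α => (∏ i, ((α i).factorial : ℝ)) • lcoeff ℝ α

theorem fischer_monomial (α : Fin n →₀ ℕ) (c : ℝ) (q : MvPolynomial (Fin n) ℝ) :
    fischer (monomial α c) q = c * ((∏ i, ((α i).factorial : ℝ)) * q.coeff α) := by
  have h : monomial α c = c • basisMonomials (Fin n) ℝ α := by
    rw [coe_basisMonomials, smul_monomial, smul_eq_mul, mul_one]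
  rw [h, map_smul, fischer, Module.Basis.constr_basis]
  simp

theorem fischer_eq_sum {p : MvPolynomial (Fin n) ℝ} {S : Finset (Fin n →₀ ℕ)}
    (hS : p.support ⊆ S) (q : MvPolynomial (Fin n) ℝ) :
    fischer p q = ∑ α ∈ S, (∏ i, ((α i).factorial : ℝ)) * (p.coeff α * q.coeff α) := by
  conv_lhs => rw [p.as_sum]
  rw [map_sum, LinearMap.sum_apply]
  refine (Finset.sum_subset hS fun α _ hα => ?_).trans
    (Finset.sum_congr rfl fun α _ => ?_)
  · rw [notMem_support_iff.1 hα, map_zero, map_zero, LinearMap.zero_apply]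
  · rw [fischer_monomial]
    ring

theorem fischer_comm (p q : MvPolynomial (Fin n) ℝ) : fischer p q = fischer q p := by
  classical
  rw [fischer_eq_sum (S := p.support ∪ q.support) Finset.subset_union_left,
    fischer_eq_sum (S := p.support ∪ q.support) Finset.subset_union_right]
  exact Finset.sum_congr rfl fun _ _ => by ring

theorem eq_zero_of_fischer_self {p : MvPolynomial (Fin n) ℝ} (h : fischer p p = 0) : p = 0 := by
  rw [fischer_eq_sum (Finset.Subset.refl _)] at h
  have hpos : ∀ α : Fin n →₀ ℕ, 0 < ∏ i, ((α i).factorial : ℝ) := fun α =>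
    Finset.prod_pos fun i _ => by exact_mod_cast Nat.factorial_pos _
  rw [Finset.sum_eq_zero_iff_of_nonneg fun α _ =>
    mul_nonneg (hpos α).le (mul_self_nonneg _)] at h
  ext α
  by_contra hα
  exact mul_ne_zero (hpos α).ne' (mul_ne_zero hα hα) (h α (mem_support_iff.2 hα))

/-- The weights `α!` are chosen for this adjunction: `(α_i + 1)! = (α_i + 1) · α_i!` supplies the
factor produced by differentiation. -/
theorem fischer_X_mul (i : Fin n) (p q : MvPolynomial (Fin n) ℝ) :
    fischer (X i * p) q = fischer p (pderiv i q) := by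
  induction p using MvPolynomial.induction_on' with
  | add p q hp hq => simp only [mul_add, map_add, LinearMap.add_apply, hp, hq]
  | monomial α c =>
    rw [X, monomial_mul, one_mul, add_comm, fischer_monomial, fischer_monomial, coeff_pderiv]
    have h : ∏ j, (((α + Finsupp.single i 1 : Fin n →₀ ℕ) j).factorial : ℝ) =
        (α i + 1) * ∏ j, ((α j).factorial : ℝ) := by
      rw [← Finset.mul_prod_erase _ _ (Finset.mem_univ i),
        ← Finset.mul_prod_erase _ (fun j => ((α j).factorial : ℝ)) (Finset.mem_univ i),
        Finset.prod_congr rfl (g := fun j => ((α j).factorial : ℝ))]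
      · simp [Nat.factorial_succ]
        ring
      · intro j hj
        rw [Finsupp.add_apply, Finsupp.single_eq_of_ne (Finset.ne_of_mem_erase hj), add_zero]
    rw [h]
    ring

/-- The polynomial `|X|^2`. -/
def normSq : MvPolynomial (Fin n) ℝ := ∑ i, X i ^ 2

/-- The Laplacian of a polynomial. -/
def laplacian : MvPolynomial (Fin n) ℝ →ₗ[ℝ] MvPolynomial (Fin n) ℝ :=
  ∑ i, (pderiv i).toLinearMap ∘ₗ (pderiv i).toLinearMap

theorem laplacian_apply (p : MvPolynomial (Fin n) ℝ) :
    laplacian p = ∑ i, pderiv i (pderiv i p) := by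
  simp [laplacian]

/-- Consequently harmonic polynomials are orthogonal to all multiples of `|X|²`. -/
theorem fischer_normSq_mul (p q : MvPolynomial (Fin n) ℝ) :
    fischer (normSq * p) q = fischer p (laplacian q) := by
  simp only [normSq, laplacian_apply, Finset.sum_mul, map_sum, LinearMap.sum_apply, pow_two,
    mul_assoc, fischer_X_mul]

/-- The linear form `⟨a, X⟩`. -/
def linForm (a : Fin n → ℝ) : MvPolynomial (Fin n) ℝ := ∑ i, C (a i) * X i

theorem pderiv_linForm (a : Fin n → ℝ) (i : Fin n) : pderiv i (linForm a) = C (a i) := by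
  simp [linForm, Pi.single_apply]

theorem pderiv_normSq (i : Fin n) :
    pderiv i (normSq : MvPolynomial (Fin n) ℝ) = 2 * X i := by
  simp [normSq, Pi.single_apply]

/-- Powers of linear forms act as point evaluations. Euler's identity splits `p` into terms `X_i ∂_i
p`, and the adjunction moves `X_i` onto the power, lowering the degree by one. -/
theorem fischer_linForm_pow (a : Fin n → ℝ) (l : ℕ) {p : MvPolynomial (Fin n) ℝ}
    (hp : p.IsHomogeneous l) : fischer p (linForm a ^ l) = l.factorial * eval a p := by
  induction l generalizing p with
  | zero =>
    rw [← totalDegree_zero_iff_isHomogeneous, totalDegree_eq_zero_iff_eq_C] at hp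
    rw [hp, C_apply, fischer_monomial]
    simp [← C_apply]
  | succ l ih =>
    have hl : ((l + 1 : ℕ) : ℝ) ≠ 0 := by positivity
    have hE := hp.sum_X_mul_pderiv
    apply mul_left_cancel₀ hl
    have h1 : ((l + 1 : ℕ) : ℝ) * fischer p (linForm a ^ (l + 1)) =
        fischer ((l + 1) • p) (linForm a ^ (l + 1)) := by
      rw [map_nsmul, LinearMap.smul_apply, nsmul_eq_mul]
    have h2 : ((l + 1 : ℕ) : ℝ) * eval a p = ∑ i, a i * eval a (pderiv i p) := by
      rw [← nsmul_eq_mul, ← map_nsmul, ← hE]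
      simp
    rw [h1, ← hE, map_sum, LinearMap.sum_apply, mul_left_comm, h2, Finset.mul_sum]
    refine Finset.sum_congr rfl fun i _ => ?_
    have h3 : pderiv i (linForm a ^ (l + 1)) = (((l + 1 : ℕ) : ℝ) * a i) • linForm a ^ l := by
      rw [pderiv_pow, pderiv_linForm, smul_eq_C_mul, C_mul]
      simp
      ring
    rw [fischer_X_mul, h3, map_smul, ih (by simpa using hp.pderiv (i := i)), smul_eq_mul,
      Nat.factorial_succ]
    push_cast
    ring

end Fischer

/-! ### Homogenized Gegenbauer polynomials -/

/-- The homogenization of the Gegenbauer polynomial: `r^l P_l^n(t)` is the value at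
`(s, p) = (r t, r^2)`. -/
def homGegenbauer {A : Type*} [CommRing A] [Algebra ℝ A] (n : ℕ) : ℕ → A → A → A
  | 0, _, _ => 1
  | 1, s, _ => s
  | l + 2, s, p => (l + n - 1 : ℝ)⁻¹ •
      ((2 * l + n : ℝ) • (s * homGegenbauer n (l + 1) s p)
        - (l + 1 : ℝ) • (p * homGegenbauer n l s p))

theorem homGegenbauer_mul_sq (n l : ℕ) (r t : ℝ) :
    homGegenbauer n l (r * t) (r ^ 2) = r ^ l * (gegenbauer n l).eval t := by
  induction l using Nat.twoStepInduction with
  | zero => simp [homGegenbauer, gegenbauer]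
  | one => simp [homGegenbauer, gegenbauer]
  | more l h0 h1 =>
    rw [homGegenbauer, gegenbauer, h0, h1]
    simp
    ring

theorem map_homGegenbauer {A B : Type*} [CommRing A] [Algebra ℝ A] [CommRing B] [Algebra ℝ B]
    (f : A →ₐ[ℝ] B) (n l : ℕ) (s p : A) :
    f (homGegenbauer n l s p) = homGegenbauer n l (f s) (f p) := by
  induction l using Nat.twoStepInduction with
  | zero => simp [homGegenbauer]
  | one => simp [homGegenbauer]
  | more l h0 h1 => simp [homGegenbauer, h0, h1]

theorem continuous_homGegenbauer {Y : Type*} [TopologicalSpace Y] (n l : ℕ) {s p : Y → ℝ}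
    (hs : Continuous s) (hp : Continuous p) :
    Continuous fun y => homGegenbauer n l (s y) (p y) := by
  induction l using Nat.twoStepInduction with
  | zero => simpa [homGegenbauer] using continuous_const
  | one => simpa [homGegenbauer] using hs
  | more l h0 h1 =>
    simp only [homGegenbauer]
    fun_prop

/-- `homGegenbauer` is homogeneous of degree `l` for the weights `1` of `s` and `2` of `p`. -/
theorem homGegenbauer_homogeneous (n l : ℕ) (c s p : ℝ) :
    homGegenbauer n l (c * s) (c ^ 2 * p) = c ^ l * homGegenbauer n l s p := by
  induction l using Nat.twoStepInduction with
  | zero => simp [homGegenbauer]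
  | one => simp [homGegenbauer]
  | more l h0 h1 =>
    simp only [homGegenbauer, h0, h1, smul_eq_mul]
    ring

/-- The leading coefficient in `s` of `homGegenbauer` is positive. -/
theorem exists_homGegenbauer_eq {n l : ℕ} (h : 2 ≤ n ∨ l ≤ 1) :
    ∃ γ : ℝ, 0 < γ ∧ ∀ {A : Type} [CommRing A] [Algebra ℝ A] (s p : A),
      ∃ r, homGegenbauer n l s p = γ • s ^ l + p * r := by
  induction l using Nat.twoStepInduction with
  | zero => exact ⟨1, one_pos, fun s p => ⟨0, by simp [homGegenbauer]⟩⟩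
  | one => exact ⟨1, one_pos, fun s p => ⟨0, by simp [homGegenbauer]⟩⟩
  | more l h0 h1 =>
    have hn : 2 ≤ n := by omega
    have hn' : (2 : ℝ) ≤ n := by exact_mod_cast hn
    have hl : (0 : ℝ) ≤ l := Nat.cast_nonneg l
    obtain ⟨γ, hγ, H⟩ := h1 (Or.inl hn)
    refine ⟨(l + n - 1 : ℝ)⁻¹ * (2 * l + n) * γ,
      mul_pos (mul_pos (inv_pos.2 (by linarith)) (by linarith)) hγ, fun s p => ?_⟩
    obtain ⟨r, hr⟩ := H s p
    refine ⟨(l + n - 1 : ℝ)⁻¹ •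
      ((2 * l + n : ℝ) • (s * r) - (l + 1 : ℝ) • homGegenbauer n l s p), ?_⟩
    rw [homGegenbauer, hr]
    simp only [Algebra.smul_def, map_mul]
    ring

/-! ### Zonal harmonics -/

section Zonal

open MvPolynomial

variable {n : ℕ}

/-- The zonal harmonic of degree `l` with pole `a`. -/
def zonal (l : ℕ) (a : Fin n → ℝ) : MvPolynomial (Fin n) ℝ :=
  homGegenbauer n l (linForm a) (C (∑ i, a i ^ 2) * normSq)

theorem zonal_succ_succ (l : ℕ) (a : Fin n → ℝ) :
    zonal (l + 2) a = (l + n - 1 : ℝ)⁻¹ • ((2 * l + n : ℝ) • (linForm a * zonal (l + 1) a)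
        - (l + 1 : ℝ) • (C (∑ i, a i ^ 2) * normSq * zonal l a)) := rfl

theorem eval_zonal (l : ℕ) (a b : Fin n → ℝ) :
    eval b (zonal l a) =
      homGegenbauer n l (∑ i, a i * b i) ((∑ i, a i ^ 2) * ∑ i, b i ^ 2) := by
  have h := map_homGegenbauer (aeval b : MvPolynomial (Fin n) ℝ →ₐ[ℝ] ℝ) n l (linForm a)
    (C (∑ i, a i ^ 2) * normSq)
  simp only [aeval_eq_eval] at h
  rw [zonal, h]
  simp [linForm, normSq]

theorem isHomogeneous_linForm (a : Fin n → ℝ) : (linForm a).IsHomogeneous 1 :=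
  IsHomogeneous.sum _ _ _ fun i _ => by
    simpa using (isHomogeneous_C (Fin n) (a i)).mul (isHomogeneous_X ℝ i)

theorem isHomogeneous_normSq : (normSq : MvPolynomial (Fin n) ℝ).IsHomogeneous 2 :=
  IsHomogeneous.sum _ _ _ fun i _ => by simpa using (isHomogeneous_X ℝ i).pow 2

theorem isHomogeneous_zonal (l : ℕ) (a : Fin n → ℝ) : (zonal l a).IsHomogeneous l := by
  induction l using Nat.twoStepInduction with
  | zero => exact isHomogeneous_one _ _
  | one => exact isHomogeneous_linForm a
  | more l h0 h1 =>
    rw [zonal_succ_succ]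
    simp only [smul_eq_C_mul]
    refine IsHomogeneous.C_mul (IsHomogeneous.sub ?_ ?_) _
    · have := (isHomogeneous_linForm a).mul h1
      rw [show 1 + (l + 1) = l + 2 by ring] at this
      exact this.C_mul _
    · have := (isHomogeneous_normSq.C_mul (∑ i, a i ^ 2)).mul h0
      rw [add_comm 2 l] at this
      exact this.C_mul _

/-- The derivative in the direction `a`. -/
def dirDeriv (a : Fin n → ℝ) : Derivation ℝ (MvPolynomial (Fin n) ℝ) (MvPolynomial (Fin n) ℝ) :=
  ∑ i, a i • pderiv i

theorem dirDeriv_apply (a : Fin n → ℝ) (p : MvPolynomial (Fin n) ℝ) :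
    dirDeriv a p = ∑ i, C (a i) * pderiv i p := by
  change Derivation.coeFnAddMonoidHom (∑ i, a i • pderiv i) p = _
  rw [map_sum, Finset.sum_apply]
  simp [smul_eq_C_mul]

theorem dirDeriv_linForm (a : Fin n → ℝ) : dirDeriv a (linForm a) = C (∑ i, a i ^ 2) := by
  simp [dirDeriv_apply, pderiv_linForm, pow_two]

theorem dirDeriv_normSq (a : Fin n → ℝ) : dirDeriv a normSq = 2 * linForm a := by
  rw [dirDeriv_apply, linForm, Finset.mul_sum]
  exact Finset.sum_congr rfl fun i _ => by rw [pderiv_normSq]; ring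

theorem smul_zonal_succ_succ (hn : 2 ≤ n) (l : ℕ) (a : Fin n → ℝ) :
    (l + n - 1 : ℝ) • zonal (l + 2) a = (2 * l + n : ℝ) • (linForm a * zonal (l + 1) a)
        - (l + 1 : ℝ) • (C (∑ i, a i ^ 2) * normSq * zonal l a) := by
  have hn' : (2 : ℝ) ≤ n := by exact_mod_cast hn
  have hl : (0 : ℝ) ≤ l := Nat.cast_nonneg l
  rw [zonal_succ_succ, smul_smul, mul_inv_cancel₀ (by linarith), one_smul]

/-- Differentiating along the pole lowers the degree of a zonal harmonic. This evaluates the cross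
term in the Laplacian of `linForm a * zonal (l + 1) a`. -/
theorem dirDeriv_zonal (hn : 2 ≤ n) (l : ℕ) (a : Fin n → ℝ) :
    dirDeriv a (zonal (l + 1) a) = (l + 1 : ℝ) • (C (∑ i, a i ^ 2) * zonal l a) := by
  have hn' : (2 : ℝ) ≤ n := by exact_mod_cast hn
  -- Two consecutive degrees are carried together because the differentiated three-term recurrence
  -- involves the derivatives of both lower terms.
  have key : ∀ l : ℕ, dirDeriv a (zonal (l + 1) a) =
        (l + 1 : ℝ) • (C (∑ i, a i ^ 2) * zonal l a) ∧
      dirDeriv a (zonal (l + 2) a) =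
        (l + 2 : ℝ) • (C (∑ i, a i ^ 2) * zonal (l + 1) a) := by
    intro l
    induction l with
    | zero =>
      have h1 : dirDeriv a (zonal 1 a) = C (∑ i, a i ^ 2) := dirDeriv_linForm a
      have h0 : zonal 0 a = 1 := rfl
      have h1' : zonal 1 a = linForm a := rfl
      refine ⟨by rw [h1, h0]; simp, ?_⟩
      have hne : ((0 : ℕ) + n - 1 : ℝ) ≠ 0 := by push_cast; linarith
      apply smul_right_injective _ hne
      have hr := congrArg (dirDeriv a) (smul_zonal_succ_succ hn 0 a)
      simp only [map_sub, Derivation.map_smul, Derivation.leibniz, smul_eq_mul, h0, h1',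
        dirDeriv_linForm, dirDeriv_normSq, Derivation.map_one_eq_zero, ← algebraMap_eq,
        Derivation.map_algebraMap] at hr ⊢
      generalize (∑ i, a i ^ 2 : ℝ) = A at hr ⊢
      rw [hr]
      simp only [Algebra.smul_def, map_add, map_sub, map_mul, map_ofNat, map_natCast, map_one]
      push_cast
      ring
    | succ l ih =>
      obtain ⟨h0, h1⟩ := ih
      refine ⟨by rw [h1]; push_cast; ring_nf, ?_⟩
      have hl : (0 : ℝ) ≤ l := Nat.cast_nonneg l
      have hne : ((l + 1 : ℕ) + n - 1 : ℝ) ≠ 0 := by push_cast; linarith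
      apply smul_right_injective _ hne
      have hr := congrArg (dirDeriv a) (smul_zonal_succ_succ hn (l + 1) a)
      have hr0 := smul_zonal_succ_succ hn l a
      simp only [map_sub, Derivation.map_smul, Derivation.leibniz, smul_eq_mul, h0, h1,
        dirDeriv_linForm, dirDeriv_normSq, ← algebraMap_eq,
        Derivation.map_algebraMap] at hr hr0 ⊢
      generalize (∑ i, a i ^ 2 : ℝ) = A at hr hr0 ⊢
      rw [hr]
      simp only [Algebra.smul_def, map_add, map_sub, map_mul, map_ofNat, map_natCast,
        map_one] at hr0 ⊢
      push_cast
      linear_combination (-(l + 2 : MvPolynomial (Fin n) ℝ) *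
        algebraMap ℝ (MvPolynomial (Fin n) ℝ) A) * hr0
  exact (key l).1

theorem laplacian_mul (p q : MvPolynomial (Fin n) ℝ) :
    laplacian (p * q) = laplacian p * q + 2 * ∑ i, pderiv i p * pderiv i q
      + p * laplacian q := by
  simp only [laplacian_apply, pderiv_mul, map_add, Finset.sum_mul, Finset.mul_sum,
    ← Finset.sum_add_distrib]
  exact Finset.sum_congr rfl fun _ _ => by ring

theorem laplacian_linForm_mul (a : Fin n → ℝ) (q : MvPolynomial (Fin n) ℝ) :
    laplacian (linForm a * q) = 2 * dirDeriv a q + linForm a * laplacian q := by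
  rw [laplacian_mul, laplacian_apply (linForm a)]
  simp [pderiv_linForm, dirDeriv_apply]

theorem laplacian_normSq_mul {l : ℕ} {q : MvPolynomial (Fin n) ℝ} (hq : q.IsHomogeneous l) :
    laplacian (normSq * q) = (2 * n + 4 * l : ℝ) • q + normSq * laplacian q := by
  have h1 : laplacian (normSq : MvPolynomial (Fin n) ℝ) = C (2 * n : ℝ) := by
    rw [laplacian_apply]
    simp only [pderiv_normSq, pderiv_mul, pderiv_X_self]
    have h2 : ∀ i : Fin n, pderiv i (2 : MvPolynomial (Fin n) ℝ) = 0 := fun i => by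
      rw [← map_ofNat C 2, pderiv_C]
    simp only [h2, zero_mul, zero_add, mul_one, Finset.sum_const, Finset.card_univ,
      Fintype.card_fin, nsmul_eq_mul, map_mul, map_ofNat, map_natCast]
    ring
  have h2 : ∑ i, pderiv i (normSq : MvPolynomial (Fin n) ℝ) * pderiv i q = 2 * (l • q) := by
    rw [← hq.sum_X_mul_pderiv, Finset.mul_sum]
    exact Finset.sum_congr rfl fun i _ => by rw [pderiv_normSq]; ring
  rw [laplacian_mul, h1, h2]
  simp only [smul_eq_C_mul, nsmul_eq_mul, map_add, map_mul, map_ofNat, map_natCast]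
  ring

/-- Apply the Laplacian to the recurrence: by induction only `2 (2l + n) ∂_a Z_{l+1}` and `(l + 1)
|a|² (2n + 4l) Z_l` remain, and `dirDeriv_zonal` makes them cancel. -/
theorem laplacian_zonal {l : ℕ} (h : 2 ≤ n ∨ l ≤ 1) (a : Fin n → ℝ) :
    laplacian (zonal l a) = 0 := by
  induction l using Nat.twoStepInduction with
  | zero =>
    rw [laplacian_apply]
    simp [zonal, homGegenbauer]
  | one =>
    rw [laplacian_apply]
    simp [zonal, homGegenbauer, pderiv_linForm]
  | more l h0 h1 =>
    have hn : 2 ≤ n := by omega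
    rw [zonal_succ_succ, map_smul, map_sub, map_smul, map_smul, laplacian_linForm_mul, mul_assoc,
      ← smul_eq_C_mul, map_smul, laplacian_normSq_mul (isHomogeneous_zonal l a),
      dirDeriv_zonal hn, h0 (Or.inl hn), h1 (Or.inl hn)]
    simp only [smul_eq_C_mul, map_add, map_mul, map_ofNat, map_natCast, map_one]
    ring

/-- Zonal harmonics reproduce: their Fischer products are zonal harmonics again. -/
theorem exists_fischer_zonal {l : ℕ} (h : 2 ≤ n ∨ l ≤ 1) :
    ∃ c : ℝ, 0 < c ∧ ∀ a b : Fin n → ℝ,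
      fischer (zonal l a) (zonal l b) = c * homGegenbauer n l (∑ i, a i * b i)
        ((∑ i, a i ^ 2) * ∑ i, b i ^ 2) := by
  obtain ⟨γ, hγ, H⟩ := exists_homGegenbauer_eq h
  refine ⟨γ * l.factorial, by positivity, fun a b => ?_⟩
  obtain ⟨r, hr⟩ := H (linForm b) (C (∑ i, b i ^ 2) * normSq)
  -- Modulo `|X|²`, the second factor is `γ ⟨b, X⟩^l`. The first factor is harmonic, so it
  -- annihilates the remainder and is evaluated at `b` by the power.
  have hz : zonal l b = γ • linForm b ^ l + normSq * (C (∑ i, b i ^ 2) * r) := by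
    rw [zonal, hr]
    ring
  conv_lhs => rw [hz]
  rw [map_add, map_smul, fischer_linForm_pow b l (isHomogeneous_zonal l a), fischer_comm _ (_ * _),
    fischer_normSq_mul, laplacian_zonal h, map_zero, add_zero, eval_zonal, smul_eq_mul, mul_assoc]

theorem eval_smul_of_isHomogeneous {l : ℕ} {p : MvPolynomial (Fin n) ℝ} (hp : p.IsHomogeneous l)
    (r : ℝ) (v : Fin n → ℝ) : eval (r • v) p = r ^ l * eval v p := by
  rw [eval_eq, eval_eq, Finset.mul_sum]
  refine Finset.sum_congr rfl fun α hα => ?_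
  have hd : r ^ l = ∏ i ∈ α.support, r ^ α i := by
    rw [Finset.prod_pow_eq_pow_sum, ← hp.degree_eq_sum_deg_support hα]
  simp only [hd, Pi.smul_apply, smul_eq_mul, mul_pow, Finset.prod_mul_distrib]
  ring

/-- A form of positive degree that is orthogonal to the multiples of `|X|^2` and constant on
spheres vanishes. -/
theorem eq_zero_of_radial (hn : 0 < n) {l : ℕ} (hl : 1 ≤ l) {p : MvPolynomial (Fin n) ℝ}
    (hp : p.IsHomogeneous l) (horth : ∀ q, fischer p (normSq * q) = 0)
    (hrad : ∀ v w : Fin n → ℝ, ∑ i, v i ^ 2 = ∑ i, w i ^ 2 → eval v p = eval w p) : p = 0 := by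
  let e : Fin n → ℝ := Pi.single ⟨0, hn⟩ 1
  have he : ∀ v : Fin n → ℝ, eval v p = √(∑ i, v i ^ 2) ^ l * eval e p := fun v => by
    rw [← eval_smul_of_isHomogeneous hp]
    apply hrad
    have hv : 0 ≤ ∑ i, v i ^ 2 := Finset.sum_nonneg fun i _ => sq_nonneg _
    simp [e, Pi.single_apply, Real.sq_sqrt hv]
  rcases Nat.even_or_odd l with ⟨k, hk⟩ | hodd
  · obtain ⟨k, rfl⟩ : ∃ j, k = j + 1 := ⟨k - 1, by omega⟩
    -- In positive even degree, a radial form is a constant times `|X|^l`, hence a multiple of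
    -- `|X|²` and orthogonal to itself.
    have hpe : p = normSq * (C (eval e p) * normSq ^ k) := by
      refine MvPolynomial.funext fun v => ?_
      have hv : 0 ≤ ∑ i, v i ^ 2 := Finset.sum_nonneg fun i _ => sq_nonneg _
      rw [he, hk, ← two_mul, pow_mul, Real.sq_sqrt hv]
      simp [normSq]
      ring
    apply eq_zero_of_fischer_self
    have h := horth (C (eval e p) * normSq ^ k)
    rwa [← hpe] at h
  -- In odd degree, `e` and `-e` have the same norm while their values are opposite.
  · have h1 := eval_smul_of_isHomogeneous hp (-1) e
    rw [hrad _ e (by simp), hodd.neg_one_pow] at h1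
    have h0 : eval e p = 0 := by linarith
    exact MvPolynomial.funext fun v => by rw [he, h0, mul_zero, map_zero]

end Zonal

/-! ### The kernel `Q` as a function of Gram matrices -/

section Geometry

variable {d m : ℕ}

/-- The Gram matrix of a tuple of points of the sphere. -/
def gramMat (z : Fin m → Sph d) : Matrix (Fin m) (Fin m) ℝ :=
  Matrix.gram ℝ fun i => (z i : EuclideanSpace ℝ (Fin d))

theorem perp_mem (z : Fin m → Sph d) (x : Sph d) :
    perp z x ∈ (Submodule.span ℝ (Set.range fun i => (z i : EuclideanSpace ℝ (Fin d))))ᗮ :=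
  Submodule.starProjection_apply_mem _ _

theorem inner_perp_right {z : Fin m → Sph d} {w : EuclideanSpace ℝ (Fin d)}
    (hw : w ∈ (Submodule.span ℝ (Set.range fun i => (z i : EuclideanSpace ℝ (Fin d))))ᗮ)
    (x : Sph d) : inner ℝ w (perp z x) = inner ℝ w (x : EuclideanSpace ℝ (Fin d)) := by
  rw [perp, ← Submodule.inner_starProjection_left_eq_right,
    Submodule.starProjection_eq_self_iff.2 hw]

/-- Projecting without division: the adjugate of the Gram matrix replaces its inverse. -/
theorem det_smul_perp (z : Fin m → Sph d) (x : Sph d) :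
    (gramMat z).det • perp z x = (gramMat z).det • (x : EuclideanSpace ℝ (Fin d)) -
      ∑ i, ((gramMat z).adjugate.mulVec
        fun j => inner ℝ (z j : EuclideanSpace ℝ (Fin d)) x) i •
        (z i : EuclideanSpace ℝ (Fin d)) := by
  set W := gramMat z with hW
  set b : Fin m → ℝ := fun j => inner ℝ (z j : EuclideanSpace ℝ (Fin d)) x with hb
  rw [perp, ← map_smul]
  refine (Submodule.eq_starProjection_of_mem_of_inner_eq_zero ?_ ?_)
  · rw [Submodule.mem_orthogonal]
    intro u hu
    induction hu using Submodule.span_induction with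
    | mem u hu =>
      obtain ⟨k, rfl⟩ := hu
      -- `W · adj(W) = det(W) · 1` is what makes the difference orthogonal to each `z_k`, with no
      -- invertibility needed.
      have h : W.mulVec (W.adjugate.mulVec b) k = W.det * b k := by
        rw [Matrix.mulVec_mulVec, Matrix.mul_adjugate, Matrix.smul_mulVec, Matrix.one_mulVec]
        rfl
      rw [inner_sub_right, inner_smul_right, inner_sum, sub_eq_zero]
      simp only [inner_smul_right]
      rw [← show b k = inner ℝ (z k : EuclideanSpace ℝ (Fin d)) x from rfl, ← h, Matrix.mulVec,
        dotProduct]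
      exact Finset.sum_congr rfl fun i _ => mul_comm _ _
    | zero => exact inner_zero_left _
    | add u v _ _ hu hv => rw [inner_add_left, hu, hv, add_zero]
    | smul c u _ hu => rw [inner_smul_left, hu, mul_zero]
  · intro w hw
    rw [sub_sub_cancel, Submodule.mem_orthogonal] at *
    exact hw _ (Submodule.sum_mem _ fun i _ =>
      Submodule.smul_mem _ _ (Submodule.subset_span ⟨i, rfl⟩))

/-- The number `det(W) ⟨y_1, y_2⟩`. -/
def detInner (z : Fin m → Sph d) (x y : Sph d) : ℝ :=
  (gramMat z).det * inner ℝ (perp z x) (perp z y)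

/-- A polynomial in inner products only: continuity at dependent `z` and invariance under rotations
can both be read off. -/
theorem detInner_eq (z : Fin m → Sph d) (x y : Sph d) :
    detInner z x y = (gramMat z).det * inner ℝ (x : EuclideanSpace ℝ (Fin d)) y -
      ∑ i, ((gramMat z).adjugate.mulVec
        fun j => inner ℝ (z j : EuclideanSpace ℝ (Fin d)) x) i *
        inner ℝ (z i : EuclideanSpace ℝ (Fin d)) y := by
  rw [detInner, inner_perp_right (perp_mem z x), ← real_inner_smul_left, det_smul_perp,
    inner_sub_left, real_inner_smul_left, sum_inner]
  simp only [real_inner_smul_left]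

theorem detInner_comm (z : Fin m → Sph d) (x y : Sph d) : detInner z x y = detInner z y x := by
  rw [detInner, detInner, real_inner_comm]

theorem detInner_rotate (A : EuclideanSpace ℝ (Fin d) ≃ₗᵢ[ℝ] EuclideanSpace ℝ (Fin d))
    (z : Fin m → Sph d) (x y : Sph d) :
    detInner (fun i => rotate A (z i)) (rotate A x) (rotate A y) = detInner z x y := by
  have hW : gramMat (fun i => rotate A (z i)) = gramMat z := by
    ext i j
    simp [gramMat, rotate]
  simp only [detInner_eq, hW]
  simp [rotate]

theorem continuous_gramMat : Continuous fun z : Fin m → Sph d => gramMat z :=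
  continuous_matrix fun i j => by
    simp only [gramMat, Matrix.gram_apply]
    fun_prop

theorem _root_.Continuous.detInner {Y : Type*} [TopologicalSpace Y] {z : Y → Fin m → Sph d}
    {x y : Y → Sph d} (hz : Continuous z) (hx : Continuous x) (hy : Continuous y) :
    Continuous fun t => KPoint.detInner (z t) (x t) (y t) := by
  simp only [detInner_eq]
  have hW := continuous_gramMat.comp hz
  have hzi : ∀ i, Continuous fun t => (z t i : EuclideanSpace ℝ (Fin d)) := fun i => by fun_prop
  refine (hW.matrix_det.mul (by fun_prop)).sub (continuous_finsetSum _ fun i _ => ?_)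
  refine Continuous.mul ?_ (by fun_prop)
  exact (continuous_apply i).comp (hW.matrix_adjugate.matrix_mulVec (by fun_prop))

/-- With `r = det(W) ‖y_1‖ ‖y_2‖`, the kernel is `r^l P_l(t)`, a polynomial in `r t = det(W) ⟨y_1,
y_2⟩` and `r²`. The normalizations disappear, and since `0⁻¹ = 0` the formula also holds when some
`y_h = 0`. -/
theorem Q_eq (l : ℕ) (x : Fin (m + 2) → Sph d) :
    Q d l x = homGegenbauer (d - m) l (detInner (tail x) (x 0) (x 1))
      (detInner (tail x) (x 0) (x 0) * detInner (tail x) (x 1) (x 1)) := by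
  set u := perp (tail x) (x 0) with hu
  set v := perp (tail x) (x 1) with hv
  set D := (gramMat (tail x)).det with hD
  have h1 : detInner (tail x) (x 0) (x 1) =
      (D * ‖u‖ * ‖v‖) * inner ℝ (‖u‖⁻¹ • u) (‖v‖⁻¹ • v) := by
    rw [detInner, ← hu, ← hv, ← hD, real_inner_smul_left, real_inner_smul_right]
    rcases eq_or_ne u 0 with h | h
    · simp [h]
    rcases eq_or_ne v 0 with h' | h'
    · simp [h']
    have := norm_ne_zero_iff.2 h
    have := norm_ne_zero_iff.2 h'
    field_simp
  have h2 : detInner (tail x) (x 0) (x 0) * detInner (tail x) (x 1) (x 1) =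
      (D * ‖u‖ * ‖v‖) ^ 2 := by
    rw [detInner, detInner, ← hu, ← hv, ← hD, real_inner_self_eq_norm_sq,
      real_inner_self_eq_norm_sq]
    ring
  rw [h1, h2, homGegenbauer_mul_sq, mul_pow, mul_pow]
  rfl

theorem continuous_tail : Continuous fun x : Fin (m + 2) → Sph d => tail x :=
  continuous_pi fun i => continuous_apply i.succ.succ

theorem continuous_Q (l : ℕ) : Continuous fun x : Fin (m + 2) → Sph d => Q d l x := by
  simp only [Q_eq]
  have h := continuous_tail (d := d) (m := m)
  have h0 := continuous_apply (A := fun _ => Sph d) (0 : Fin (m + 2))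
  have h1 := continuous_apply (A := fun _ => Sph d) (1 : Fin (m + 2))
  exact continuous_homGegenbauer _ _ (h.detInner h0 h1)
    ((h.detInner h0 h0).mul (h.detInner h1 h1))

theorem continuous_T (l : ℕ) {G : (Fin (m + 1) → Sph d) → ℝ} (hG : Continuous G) :
    Continuous (T d l G) := by
  have h := continuous_tail (d := d) (m := m)
  have h0 := continuous_apply (A := fun _ => Sph d) (0 : Fin (m + 2))
  have h1 := continuous_apply (A := fun _ => Sph d) (1 : Fin (m + 2))
  exact ((hG.comp (h0.finCons h)).mul (hG.comp (h1.finCons h))).mul (continuous_Q l)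

theorem DependsOnlyOnInner.rotate {k : ℕ} {G : (Fin k → Sph d) → ℝ} (hG : DependsOnlyOnInner G) :
    IsRotationInvariant G := fun A x => hG _ _ fun i j _ => by
  simp [KPoint.rotate]

theorem isRotationInvariant_T (l : ℕ) {G : (Fin (m + 1) → Sph d) → ℝ}
    (hG : DependsOnlyOnInner G) : IsRotationInvariant (T d l G) := by
  intro A x
  have ht : tail (fun i => rotate A (x i)) = fun i => rotate A (tail x i) := rfl
  have hc : ∀ y : Sph d, G (Fin.cons (rotate A y) fun i => rotate A (tail x i)) =
      G (Fin.cons y (tail x)) := fun y => by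
    rw [← hG.rotate A (Fin.cons y (tail x))]
    congr 1
    funext i
    refine Fin.cases ?_ (fun j => ?_) i <;> simp
  rw [T, T, Q_eq, Q_eq, ht]
  simp only [hc, detInner_rotate]

theorem T_cons (l : ℕ) (G : (Fin (m + 1) → Sph d) → ℝ) (x y : Sph d) (z : Fin m → Sph d) :
    T d l G (Fin.cons x (Fin.cons y z)) = G (Fin.cons x z) * G (Fin.cons y z) *
      homGegenbauer (d - m) l (detInner z x y) (detInner z x x * detInner z y y) := by
  rw [T, Q_eq]
  rfl

theorem T_symm (l : ℕ) (G : (Fin (m + 1) → Sph d) → ℝ) (x y : Sph d) (z : Fin m → Sph d) :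
    T d l G (Fin.cons x (Fin.cons y z)) = T d l G (Fin.cons y (Fin.cons x z)) := by
  rw [T_cons, T_cons, detInner_comm z x y, mul_comm (detInner z x x), mul_comm (G (Fin.cons x z))]

end Geometry

/-! ### Measures -/

section Measures

variable {d : ℕ}

theorem continuous_rotate (A : EuclideanSpace ℝ (Fin d) ≃ₗᵢ[ℝ] EuclideanSpace ℝ (Fin d)) :
    Continuous (rotate A) :=
  (A.continuous.comp continuous_subtype_val).subtype_mk _

-- Up to a constant, `toSphere` measures a set by the volume of the cone over it. An orthogonal map
-- carries cones to cones and preserves volume.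
open scoped Pointwise in
theorem map_rotate_sigma (A : EuclideanSpace ℝ (Fin d) ≃ₗᵢ[ℝ] EuclideanSpace ℝ (Fin d)) :
    (sigma d).map (rotate A) = sigma d := by
  rw [sigma, Measure.map_smul]
  congr 1
  ext s hs
  rw [Measure.map_apply (continuous_rotate A).measurable hs, Measure.toSphere_apply' _ hs,
    Measure.toSphere_apply' _ ((continuous_rotate A).measurable hs)]
  congr 1
  rw [← A.measurePreserving.measure_preimage_emb A.toHomeomorph.measurableEmbedding
    (Set.Ioo (0 : ℝ) 1 • (Subtype.val '' s))]
  congr 1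
  ext v
  simp only [Set.mem_smul, Set.mem_image, Set.mem_preimage]
  constructor
  · rintro ⟨r, hr, _, ⟨x, hx, rfl⟩, rfl⟩
    exact ⟨r, hr, _, ⟨_, hx, rfl⟩, by simp [rotate]⟩
  · rintro ⟨r, hr, _, ⟨x, hx, rfl⟩, hv⟩
    refine ⟨r, hr, _, ⟨rotate A.symm x, ?_, rfl⟩, ?_⟩
    · simpa [rotate] using hx
    · apply A.injective
      simp [rotate, ← hv]

theorem integral_rotate_sigma (A : EuclideanSpace ℝ (Fin d) ≃ₗᵢ[ℝ] EuclideanSpace ℝ (Fin d))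
    {f : Sph d → ℝ} (hf : Continuous f) :
    ∫ x, f (rotate A x) ∂sigma d = ∫ x, f x ∂sigma d := by
  conv_rhs => rw [← map_rotate_sigma A]
  exact (integral_map (continuous_rotate A).measurable.aemeasurable
    hf.aestronglyMeasurable).symm

theorem integrable_of_continuous {X : Type*} [TopologicalSpace X] [CompactSpace X]
    [MeasurableSpace X] [OpensMeasurableSpace X] (μ : Measure X)
    [IsFiniteMeasure μ] {f : X → ℝ} (hf : Continuous f) : Integrable f μ :=
  hf.integrable_of_hasCompactSupport (HasCompactSupport.of_compactSpace f)

theorem signed_integral_nonneg {ι : Type*} [Fintype ι] {K : Sph d → Sph d → ℝ}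
    {F : ι → Sph d → ℝ} (hF : ∀ i, Continuous (F i)) (hK : ∀ x y, K x y = ∑ i, F i x * F i y)
    (ν : SignedMeasure (Sph d)) : 0 ≤ ∫ᵛ y, (∫ᵛ x, K x y ∂<•ν) ∂<•ν := by
  have : IsFiniteMeasure ν.variation := by
    rw [← SignedMeasure.totalVariation_eq_variation]
    infer_instance
  have hint : ∀ {f : Sph d → ℝ}, Continuous f → ν.Integrable f := fun hf =>
    integrable_of_continuous _ hf
  have h1 : ∀ y, ∫ᵛ x, K x y ∂<•ν = ∑ i, (∫ᵛ x, F i x ∂<•ν) * F i y := fun y => by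
    simp only [hK]
    rw [VectorMeasure.integral_finsetSum (f := fun i x => F i x * F i y) _
      fun i _ => hint ((hF i).mul continuous_const)]
    refine Finset.sum_congr rfl fun i _ => ?_
    simp only [mul_comm _ (F i y), ← smul_eq_mul]
    rw [VectorMeasure.integral_fun_smul]
  simp only [h1]
  rw [VectorMeasure.integral_finsetSum (f := fun i y => (∫ᵛ x, F i x ∂<•ν) * F i y) _
    fun i _ => hint (continuous_const.mul (hF i))]
  refine Finset.sum_nonneg fun i _ => ?_
  simp only [← smul_eq_mul]
  rw [VectorMeasure.integral_fun_smul]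
  exact mul_self_nonneg _

theorem continuous_cons {n : ℕ} :
    Continuous fun p : Sph d × (Fin n → Sph d) => (Fin.cons p.1 p.2 : Fin (n + 1) → Sph d) :=
  continuous_pi fun i => Fin.cases (by simpa using continuous_fst)
    (fun j => by simp only [Fin.cons_succ]; fun_prop) i

theorem continuous_integral_cons {n : ℕ} {K : (Fin (n + 1) → Sph d) → ℝ} (hK : Continuous K)
    (μ : Measure (Sph d)) [IsFiniteMeasure μ] :
    Continuous fun z : Fin n → Sph d => ∫ x, K (Fin.cons x z) ∂μ := by
  have h := continuous_parametric_integral_of_continuous (μ := μ)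
    (f := fun (z : Fin n → Sph d) (x : Sph d) => K (Fin.cons x z))
    (hK.comp (continuous_cons.comp continuous_swap)) isCompact_univ
  simpa using h

theorem integral_pi_succ {n : ℕ} {K : (Fin (n + 1) → Sph d) → ℝ} (hK : Continuous K)
    (μ : Measure (Sph d)) [IsProbabilityMeasure μ] :
    ∫ x, K x ∂(Measure.pi fun _ : Fin (n + 1) => μ) =
      ∫ z, ∫ x, K (Fin.cons x z) ∂μ ∂(Measure.pi fun _ : Fin n => μ) := by
  have h := (measurePreserving_piFinSuccAbove (fun _ : Fin (n + 1) => μ) 0).symm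
  rw [← h.integral_comp']
  have hc : Continuous fun p : Sph d × (Fin n → Sph d) => K (Fin.cons p.1 p.2) :=
    hK.comp continuous_cons
  rw [← integral_prod_symm _ (integrable_of_continuous _ hc)]
  refine integral_congr_ae (.of_forall fun p => ?_)
  simp [MeasurableEquiv.piFinSuccAbove_symm_apply, Fin.insertNthEquiv]

/-- Fubini with `x_3, …, x_k` outermost, so that the inner double integral has them fixed. -/
theorem energy_eq {m : ℕ} {K : (Fin (m + 2) → Sph d) → ℝ} (hK : Continuous K)
    (μ : Measure (Sph d)) [IsProbabilityMeasure μ] :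
    energy K μ = ∫ z, ∫ y, ∫ x, K (Fin.cons x (Fin.cons y z)) ∂μ ∂μ
      ∂(Measure.pi fun _ : Fin m => μ) := by
  rw [energy, integral_pi_succ hK, integral_pi_succ (continuous_integral_cons hK μ)]

theorem integral_integral_eq_sum {ι : Type*} [Fintype ι] {K : Sph d → Sph d → ℝ}
    {F : ι → Sph d → ℝ} (hF : ∀ i, Continuous (F i)) (hK : ∀ x y, K x y = ∑ i, F i x * F i y)
    (μ : Measure (Sph d)) [IsProbabilityMeasure μ] :
    ∫ y, ∫ x, K x y ∂μ ∂μ = ∑ i, (∫ x, F i x ∂μ) ^ 2 := by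
  simp only [hK]
  have h1 : ∀ y, ∫ x, ∑ i, F i x * F i y ∂μ = ∑ i, (∫ x, F i x ∂μ) * F i y := fun y => by
    rw [integral_finsetSum (f := fun i x => F i x * F i y) _ fun i _ =>
      integrable_of_continuous μ ((hF i).mul continuous_const)]
    simp only [integral_mul_const]
  simp only [h1]
  rw [integral_finsetSum (f := fun i y => (∫ x, F i x ∂μ) * F i y) _ fun i _ =>
    integrable_of_continuous μ (continuous_const.mul (hF i))]
  simp only [integral_const_mul, pow_two]

end Measures

/-! ### Polynomials whose coefficients depend continuously on a parameter -/

section ContinuousCoeff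

open MvPolynomial

variable {Y : Type*} [TopologicalSpace Y] {n : ℕ}

/-- The coefficients of the polynomials `p y` depend continuously on `y`. -/
def ContinuousCoeff (p : Y → MvPolynomial (Fin n) ℝ) : Prop :=
  ∀ α, Continuous fun y => (p y).coeff α

theorem continuousCoeff_const (p : MvPolynomial (Fin n) ℝ) : ContinuousCoeff fun _ : Y => p :=
  fun _ => continuous_const

theorem continuousCoeff_C {f : Y → ℝ} (hf : Continuous f) :
    ContinuousCoeff fun y => (C (f y) : MvPolynomial (Fin n) ℝ) := fun α => by
  simp only [coeff_C]
  split_ifs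
  exacts [hf, continuous_const]

namespace ContinuousCoeff

variable {p q : Y → MvPolynomial (Fin n) ℝ}

theorem mul (hp : ContinuousCoeff p) (hq : ContinuousCoeff q) :
    ContinuousCoeff fun y => p y * q y := fun α => by
  simp only [coeff_mul]
  exact continuous_finsetSum _ fun β _ => (hp _).mul (hq _)

theorem sub (hp : ContinuousCoeff p) (hq : ContinuousCoeff q) :
    ContinuousCoeff fun y => p y - q y := fun α => by
  simp only [coeff_sub]
  exact (hp α).sub (hq α)

theorem const_smul (hp : ContinuousCoeff p) (c : ℝ) :
    ContinuousCoeff fun y => c • p y := fun α => by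
  simp only [coeff_smul]
  exact (hp α).const_smul c

theorem homGegenbauer (hp : ContinuousCoeff p) (hq : ContinuousCoeff q) (k l : ℕ) :
    ContinuousCoeff fun y => homGegenbauer k l (p y) (q y) := by
  induction l using Nat.twoStepInduction with
  | zero => exact continuousCoeff_const 1
  | one => exact hp
  | more l h0 h1 =>
    exact (((hp.mul h1).const_smul _).sub ((hq.mul h0).const_smul _)).const_smul _

end ContinuousCoeff

theorem continuousCoeff_zonal {a : Y → Fin n → ℝ} (ha : Continuous a) (l : ℕ) :
    ContinuousCoeff fun y => zonal l (a y) := by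
  have hi : ∀ i, Continuous fun y => a y i := fun i => by fun_prop
  refine ContinuousCoeff.homGegenbauer (fun α => ?_) ?_ n l
  · simp only [linForm, coeff_sum, coeff_C_mul]
    fun_prop
  · exact (continuousCoeff_C (by fun_prop)).mul (continuousCoeff_const _)

/-- Provides one finite set of exponents that serves all forms of degree `l` at once, whatever the
pole. -/
theorem support_subset_finsuppAntidiag {l : ℕ} {p : MvPolynomial (Fin n) ℝ}
    (hp : p.IsHomogeneous l) : p.support ⊆ Finset.univ.finsuppAntidiag l := fun α hα => by
  rw [Finset.mem_finsuppAntidiag]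
  refine ⟨?_, Finset.subset_univ _⟩
  rw [hp.degree_eq_sum_deg_support hα]
  exact (Finset.sum_subset (Finset.subset_univ _) fun i _ hi => by simpa using hi).symm

end ContinuousCoeff

/-! ### Features of the kernel for fixed last inputs -/

section Features

open MvPolynomial

variable {d m : ℕ}

/-- An orthonormal frame of the orthogonal complement of the span of `z`. -/
theorem exists_frame {z : Fin m → Sph d} (hz : (gramMat z).det ≠ 0) :
    ∃ u : Fin (d - m) → EuclideanSpace ℝ (Fin d), Orthonormal ℝ u ∧
      (∀ i j, inner ℝ (z j : EuclideanSpace ℝ (Fin d)) (u i) = 0) ∧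
      ∀ x y : Sph d, inner ℝ (perp z x) (perp z y) =
        ∑ i, inner ℝ (u i) (x : EuclideanSpace ℝ (Fin d)) *
          inner ℝ (u i) (y : EuclideanSpace ℝ (Fin d)) := by
  set U := Submodule.span ℝ (Set.range fun i => (z i : EuclideanSpace ℝ (Fin d))) with hU
  have hli : LinearIndependent ℝ fun i => (z i : EuclideanSpace ℝ (Fin d)) :=
    Matrix.linearIndependent_of_det_gram_ne_zero hz
  have hfr : Module.finrank ℝ Uᗮ = d - m := by
    have h1 := U.finrank_add_finrank_orthogonal
    rw [hU, finrank_span_eq_card hli, ← hU, finrank_euclideanSpace_fin, Fintype.card_fin] at h1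
    omega
  let b := (stdOrthonormalBasis ℝ Uᗮ).reindex (finCongr hfr)
  refine ⟨fun i => b i, ?_, fun i j => ?_, fun x y => ?_⟩
  · exact b.orthonormal.comp_linearIsometry Uᗮ.subtypeₗᵢ
  · exact (Submodule.mem_orthogonal _ _).1 (b i).2 _ (Submodule.subset_span ⟨j, rfl⟩)
  · have h := b.sum_inner_mul_inner ⟨perp z x, perp_mem z x⟩ ⟨perp z y, perp_mem z y⟩
    rw [Submodule.coe_inner] at h
    rw [← h]
    refine Finset.sum_congr rfl fun i _ => ?_
    rw [Submodule.coe_inner, Submodule.coe_inner, real_inner_comm, inner_perp_right (b i).2,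
      inner_perp_right (b i).2]

/-- Integrals of zonal harmonics against functions invariant under the stabilizer of `z`. -/
theorem integral_mul_coeff_zonal_eq_zero {z : Fin m → Sph d} (hz : (gramMat z).det ≠ 0)
    {n l : ℕ} (hn : 0 < n) (h : 2 ≤ n ∨ l ≤ 1) (hl : 1 ≤ l)
    {u : Fin n → EuclideanSpace ℝ (Fin d)} (hu : Orthonormal ℝ u)
    (huz : ∀ i j, inner ℝ (z j : EuclideanSpace ℝ (Fin d)) (u i) = 0)
    (hperp : ∀ x y : Sph d, inner ℝ (perp z x) (perp z y) =
        ∑ i, inner ℝ (u i) (x : EuclideanSpace ℝ (Fin d)) *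
          inner ℝ (u i) (y : EuclideanSpace ℝ (Fin d)))
    {g : Sph d → ℝ} (hg : Continuous g)
    (hgA : ∀ A : EuclideanSpace ℝ (Fin d) ≃ₗᵢ[ℝ] EuclideanSpace ℝ (Fin d),
      (∀ j, rotate A (z j) = z j) → ∀ x, g (rotate A x) = g x)
    (hd : 0 < d) (α : Fin n →₀ ℕ) :
    ∫ x : Sph d, g x * (zonal l fun i => inner ℝ (u i)
      (x : EuclideanSpace ℝ (Fin d))).coeff α ∂sigma d = 0 := by
  have := isProbabilityMeasure_sigma d hd
  set a : Sph d → Fin n → ℝ := fun x i => inner ℝ (u i) (x : EuclideanSpace ℝ (Fin d)) with ha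
  have hac : Continuous a := by fun_prop
  have hZ : ∀ x, (zonal l (a x)).IsHomogeneous l := fun x => isHomogeneous_zonal l _
  have hZc := continuousCoeff_zonal hac l
  set S : Finset (Fin n →₀ ℕ) := Finset.univ.finsuppAntidiag l with hS
  -- The average of `g(x) · zonal l (a x)` over the sphere, taken coefficientwise. Its coefficients
  -- are the integrals in question, so the goal becomes `p = 0`.
  set p : MvPolynomial (Fin n) ℝ :=
    ∑ β ∈ S, monomial β (∫ x, g x * (zonal l (a x)).coeff β ∂sigma d) with hp
  have hcoeff : ∀ β, p.coeff β = ∫ x, g x * (zonal l (a x)).coeff β ∂sigma d := fun β => by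
    rw [hp, coeff_sum]
    simp only [coeff_monomial, Finset.sum_ite_eq']
    split_ifs with hβ
    · rfl
    · have h0 : ∀ x, (zonal l (a x)).coeff β = 0 := fun x => by
        by_contra hne
        exact hβ (support_subset_finsuppAntidiag (hZ x) (mem_support_iff.2 hne))
      simp [h0]
  have hph : p.IsHomogeneous l := by
    refine IsHomogeneous.sum _ _ _ fun β hβ => isHomogeneous_monomial _ ?_
    rw [Finsupp.degree_eq_sum]
    exact (Finset.mem_finsuppAntidiag.1 hβ).1
  have hfis : ∀ q, fischer p q = ∫ x, g x * fischer (zonal l (a x)) q ∂sigma d := fun q => by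
    have h1 : ∀ x, g x * fischer (zonal l (a x)) q = ∑ β ∈ S,
        (∏ i, ((β i).factorial : ℝ)) * q.coeff β * (g x * (zonal l (a x)).coeff β) := fun x => by
      rw [fischer_eq_sum (support_subset_finsuppAntidiag (hZ x)), Finset.mul_sum]
      exact Finset.sum_congr rfl fun β _ => by ring
    simp only [h1]
    rw [integral_finsetSum (f := fun β x =>
        (∏ i, ((β i).factorial : ℝ)) * q.coeff β * (g x * (zonal l (a x)).coeff β)) _ fun β _ =>
      integrable_of_continuous _ (continuous_const.mul (hg.mul (hZc β))),
      fischer_eq_sum (support_subset_finsuppAntidiag hph)]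
    refine Finset.sum_congr rfl fun β _ => ?_
    rw [integral_const_mul, hcoeff]
    ring
  -- Evaluation at `v` is a Fischer product with `⟨v, X⟩^l`, so it commutes with the averaging.
  have heval : ∀ v, eval v p = ∫ x, g x * eval v (zonal l (a x)) ∂sigma d := fun v => by
    have hne : (l.factorial : ℝ) ≠ 0 := by positivity
    apply mul_left_cancel₀ hne
    rw [← fischer_linForm_pow v l hph, hfis, ← integral_const_mul]
    refine integral_congr_ae (.of_forall fun x => ?_)
    simp only [fischer_linForm_pow v l (hZ x)]
    ring
  suffices hp0 : p = 0 by rw [← hcoeff α, hp0, coeff_zero]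
  refine eq_zero_of_radial hn hl hph (fun q => ?_) fun v w hvw => ?_
  · rw [hfis]
    simp [fischer_comm _ (normSq * q), fischer_normSq_mul, laplacian_zonal h]
  -- `V` embeds `ℝ^n` isometrically into `span(z)ᗮ`. For `|v| = |w|`, the reflection exchanging `V
  -- v` and `V w` fixes every `z_j`, and substituting it in the integral turns the value at `v` into
  -- the value at `w`.
  · set V : (Fin n → ℝ) → EuclideanSpace ℝ (Fin d) := fun v => ∑ i, v i • u i with hV
    have hVa : ∀ v x, ∑ i, a x i * v i = inner ℝ (V v) (x : EuclideanSpace ℝ (Fin d)) :=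
      fun v x => by
        simp only [hV, sum_inner, real_inner_smul_left, ha]
        exact Finset.sum_congr rfl fun i _ => mul_comm _ _
    have hVn : ∀ v, ‖V v‖ ^ 2 = ∑ i, v i ^ 2 := fun v => by
      rw [← real_inner_self_eq_norm_sq, hV, hu.inner_sum]
      simp [pow_two]
    have hnorm : ‖V v‖ = ‖V w‖ := by
      rw [← sq_eq_sq₀ (norm_nonneg _) (norm_nonneg _), hVn, hVn, hvw]
    set A := (Submodule.span ℝ {V v - V w})ᗮ.reflection with hA
    have hAv : A (V v) = V w := Submodule.reflection_sub hnorm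
    have hAz : ∀ j, rotate A (z j) = z j := fun j => by
      apply Subtype.ext
      refine Submodule.reflection_mem_subspace_eq_self ?_
      rw [Submodule.mem_orthogonal_singleton_iff_inner_left, inner_sub_right]
      simp [hV, inner_sum, inner_smul_right, huz]
    -- `|a(x)|²` is the squared norm of the projection of `x`, unchanged by a rotation fixing `z`.
    have hD : ∀ x, ∑ i, a (rotate A x) i ^ 2 = ∑ i, a x i ^ 2 := fun x => by
      have h1 := detInner_rotate A z x x
      simp only [hAz] at h1
      rw [detInner, detInner, hperp, hperp] at h1
      simpa only [pow_two] using mul_left_cancel₀ hz h1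
    have hf : Continuous fun x => g x * eval w (zonal l (a x)) := by
      simp only [eval_zonal]
      exact hg.mul (continuous_homGegenbauer _ _ (by fun_prop) (by fun_prop))
    rw [heval, heval, ← integral_rotate_sigma A hf]
    refine integral_congr_ae (.of_forall fun x => ?_)
    simp only [eval_zonal, hD, hgA A hAz, hVa, hvw]
    congr 2
    rw [← hAv]
    exact (A.inner_map_map _ _).symm

/-- For fixed last inputs, `T` is a finite sum of squares of continuous functions, which have mean
zero for `l ≥ 1`. -/
theorem exists_features {l : ℕ} (hmd : m + 2 ≤ d + 1) (hl : m + 2 = d + 1 → l ≤ 1)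
    {G : (Fin (m + 1) → Sph d) → ℝ} (hGc : Continuous G) (hG : DependsOnlyOnInner G)
    (z : Fin m → Sph d) :
    ∃ (ι : Type) (_ : Fintype ι) (F : ι → Sph d → ℝ), (∀ i, Continuous (F i)) ∧
      (∀ x y, T d l G (Fin.cons x (Fin.cons y z)) = ∑ i, F i x * F i y) ∧
      (1 ≤ l → ∀ i, ∫ x, F i x ∂sigma d = 0) := by
  have hg : Continuous fun x : Sph d => G (Fin.cons x z) :=
    hGc.comp (continuous_cons.comp (continuous_id.prodMk continuous_const))
  rcases Nat.eq_zero_or_pos l with rfl | hl1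
  · exact ⟨Unit, inferInstance, fun _ x => G (Fin.cons x z), fun _ => hg,
      fun x y => by simp [T_cons, homGegenbauer], fun h => absurd h (by norm_num)⟩
  -- For dependent `z` and `l ≥ 1` the kernel vanishes identically, so no features are needed.
  by_cases hz : (gramMat z).det = 0
  · refine ⟨Empty, inferInstance, fun i => i.elim, fun i => i.elim, fun x y => ?_,
      fun _ i => i.elim⟩
    have h0 := homGegenbauer_homogeneous (d - m) l 0 0 0
    rw [zero_pow hl1.ne', zero_mul, mul_zero] at h0
    simp [T_cons, detInner, hz] at h0 ⊢
    simp [h0]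
  obtain ⟨u, hu, huz, hperp⟩ := exists_frame hz
  have hn : 0 < d - m := by omega
  -- `d - m = 1` is exactly the case `k = d + 1`, where `l ≤ 1` is assumed.
  have hnl : 2 ≤ d - m ∨ l ≤ 1 := by omega
  obtain ⟨c, hc, hfis⟩ := exists_fischer_zonal hnl
  set a : Sph d → Fin (d - m) → ℝ :=
    fun x i => inner ℝ (u i) (x : EuclideanSpace ℝ (Fin d)) with ha
  have hac : Continuous a := by fun_prop
  set D := (gramMat z).det with hD
  have hD0 : 0 ≤ D := (Matrix.posSemidef_gram ℝ _).det_nonneg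
  set S : Finset (Fin (d - m) →₀ ℕ) := Finset.univ.finsuppAntidiag l with hS
  -- The weight of the monomial `α` in `D^l c⁻¹ · fischer`. It is nonnegative because a Gram
  -- determinant is, so its square root can be shared between the two factors.
  let k : (Fin (d - m) →₀ ℕ) → ℝ := fun α => D ^ l * c⁻¹ * ∏ i, ((α i).factorial : ℝ)
  have hk : ∀ α, 0 ≤ k α := fun α => by positivity
  refine ⟨S, inferInstance, fun α x => √(k α) * (G (Fin.cons x z) * (zonal l (a x)).coeff α),
    fun α => continuous_const.mul (hg.mul (continuousCoeff_zonal hac l α)), fun x y => ?_,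
    fun _ α => ?_⟩
  · have hT : T d l G (Fin.cons x (Fin.cons y z)) = G (Fin.cons x z) * G (Fin.cons y z) *
        (D ^ l * c⁻¹ * fischer (zonal l (a x)) (zonal l (a y))) := by
      have h1 : detInner z x x * detInner z y y =
          D ^ 2 * ((∑ i, a x i ^ 2) * ∑ i, a y i ^ 2) := by
        simp only [detInner, hperp, pow_two, ha]
        ring
      have h2 : detInner z x y = D * ∑ i, a x i * a y i := by rw [detInner, hperp]
      rw [T_cons, h1, h2, homGegenbauer_homogeneous, hfis]
      field_simp
    rw [hT, fischer_eq_sum (support_subset_finsuppAntidiag (isHomogeneous_zonal l (a x))),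
      Finset.sum_coe_sort S fun α => (√(k α) * (G (Fin.cons x z) * (zonal l (a x)).coeff α)) *
        (√(k α) * (G (Fin.cons y z) * (zonal l (a y)).coeff α)), Finset.mul_sum, Finset.mul_sum]
    refine Finset.sum_congr rfl fun α _ => ?_
    have hs := Real.mul_self_sqrt (hk α)
    linear_combination (-(G (Fin.cons x z) * (zonal l (a x)).coeff α) *
      (G (Fin.cons y z) * (zonal l (a y)).coeff α)) * hs
  · rw [integral_const_mul, integral_mul_coeff_zonal_eq_zero hz hn hnl hl1 hu huz hperp hg
      (fun A hA x => ?_) (by omega), mul_zero]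
    rw [← hG.rotate A (Fin.cons x z)]
    congr 1
    funext i
    refine Fin.cases ?_ (fun j => ?_) i <;> simp [hA]

end Features

end KPoint

end

theorem corollary6p3 (d m l : ℕ) (hmd : m + 2 ≤ d + 1) (hl : m + 2 = d + 1 → l ≤ 1)
    (G : (Fin (m + 1) → KPoint.Sph d) → ℝ) (hGc : Continuous G)
    (hG : KPoint.DependsOnlyOnInner G) :
    KPoint.IsRotationInvariant (KPoint.T d l G) ∧
    KPoint.IsKPosDef (KPoint.T d l G) ∧
    (1 ≤ l →
      IsGLB {e : ℝ | ∃ μ : MeasureTheory.Measure (KPoint.Sph d),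
          MeasureTheory.IsProbabilityMeasure μ ∧ KPoint.energy (KPoint.T d l G) μ = e}
        (KPoint.energy (KPoint.T d l G) (KPoint.sigma d)) ∧
      KPoint.energy (KPoint.T d l G) (KPoint.sigma d) = 0) := by
  have hT := KPoint.continuous_T l hGc
  refine ⟨KPoint.isRotationInvariant_T l hG, ⟨hT, fun x y z => KPoint.T_symm l G x y z,
    fun z => ⟨fun x y => KPoint.T_symm l G x y z, fun ν => ?_⟩⟩, fun hl1 => ?_⟩
  · obtain ⟨ι, _, F, hF, hK, _⟩ := KPoint.exists_features hmd hl hGc hG z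
    exact KPoint.signed_integral_nonneg hF hK ν
  · have hσ := KPoint.isProbabilityMeasure_sigma d (by omega)
    have h0 : KPoint.energy (KPoint.T d l G) (KPoint.sigma d) = 0 := by
      rw [KPoint.energy_eq hT]
      refine integral_eq_zero_of_ae (.of_forall fun z => ?_)
      -- Already for each fixed `z` the inner double integral is a sum of squared means, all zero
      -- for `σ`.
      obtain ⟨ι, _, F, hF, hK, hz⟩ := KPoint.exists_features hmd hl hGc hG z
      simp [KPoint.integral_integral_eq_sum hF hK, hz hl1]
    refine ⟨IsLeast.isGLB ⟨⟨_, hσ, rfl⟩, ?_⟩, h0⟩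
    rintro _ ⟨μ, hμ, rfl⟩
    rw [h0, KPoint.energy_eq hT]
    refine integral_nonneg fun z => ?_
    obtain ⟨ι, _, F, hF, hK, _⟩ := KPoint.exists_features hmd hl hGc hG z
    rw [KPoint.integral_integral_eq_sum hF hK]
    exact Finset.sum_nonneg fun i _ => sq_nonneg _
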